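/- Let $n\ge 1$, $N=2^n$, and let $\mathcal H=\mathbb C^n\otimes\mathbb C^{2^n}$ have the orthonormal basis $|d,\vec x\rangle$, where $d\in\{1,\dots,n\}$ is a direction (the coin) and $\vec x\in\{0,1\}^n$ is a node of the $n$-cube. Let $S|d,\vec x\rangle=|d,\vec x\oplus\vec e_d\rangle$, let $|s\rangle=\frac1{\sqrt n}\sum_d|d\rangle$ and let $G=-I+2|s\rangle\langle s|$. Let $f:\{0,1\}^n\to\{0,1\}$ take the value $1$ at exactly one node $\vec w$, the marked node. The coin oracle $C'$ of $f$ applies $-I$ to the coin register at the marked node and $G$ to the coin register at every other node. Put $U'=S\cdot C'$ and $|\psi_0\rangle=\frac1{\sqrt{n2^n}}\sum_{d,\vec x}|d,\vec x\rangle$, and let $t_f=\frac{\pi}{2}\sqrt{2^{n-1}}$. (1) There are constants $C,K>0$ and $k\ge 1$ such that for all $n\ge k$, all such $f$, and every non-negative integer $t$ with $|t-t_f|\le 1$ (in particular for the integer closest to $t_f$), the probability $p=\sum_d|\langle d,\vec w|(U')^t|\psi_0\rangle|^2$ that a measurement of $(U')^t|\psi_0\rangle$ in the basis $|d,\vec x\rangle$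 gives the marked node satisfies $$0\le \tfrac12-p\le \frac Cn,$$ that is, $p=\frac12-O(1/n)$. The state $(U')^t|\psi_0\rangle$ is produced from $|\psi_0\rangle$ by the program that $t$ times calls the coin oracle $C'$ and then applies the fixed gate $S$; this program does not depend on $f$, and makes at most $K\sqrt N$ oracle calls. (2) Consequently search takes $O(\sqrt N)$ oracle calls: for every $\varepsilon>0$ there are a number of repetitions $r$ and constants $K>0$ and $k\ge 1$, depending only on $\varepsilon$, such that for all $n\ge k$, all such $f$, and every non-negative integer $t$ with $|t-t_f|\le 1$, the following procedure outputs $\vec w$ with probability at least $1-\varepsilon$: perform $r$ independent runs of the program in (1) from $|\psi_0\rangle$, each followed by a measurement in the basis $|d,\vec x\rangle$, evaluate $f$ at the $r$ observed nodes, and output the first observed node at which $f$ is $1$. Its total number of oracle calls, $rt$ calls to $C'$ and $r$ evaluations of $f$, is at most $K\sqrt N$. -/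

import Mathlib

open scoped Matrix

noncomputable section

namespace HypercubeSearch

/-- Nodes of the `n`-cube: `n`-bit strings, with bitwise addition modulo 2. -/
abbrev Node (n : ℕ) : Type := Fin n → ZMod 2

/-- Labels `(d, x)` of the computational basis states `|d, x⟩` of `ℂⁿ ⊗ ℂ^(2^n)`. -/
abbrev Label (n : ℕ) : Type := Fin n × Node n

/-- State vectors, given by their amplitudes in the basis `|d, x⟩`. -/
abbrev State (n : ℕ) : Type := Label n → ℂ

abbrev Operator (n : ℕ) : Type := Matrix (Label n) (Label n) ℂ

/-- The equal superposition over the `n` directions. -/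
def coinState (n : ℕ) : Fin n → ℂ := fun _ => ((1 / √(n : ℝ) : ℝ) : ℂ)

/-- The equal superposition over the `2^n` nodes. -/
def nodeState (n : ℕ) : Node n → ℂ := fun _ => ((1 / √((2 : ℝ) ^ n) : ℝ) : ℂ)

/-- The initial state, the tensor product of the two equal superpositions. -/
def initialState (n : ℕ) : State n := fun b => coinState n b.1 * nodeState n b.2

/-- The Grover diffusion coin `G = -I + 2 |s⟩⟨s|`, with `s` the equal superposition. -/
def grover (n : ℕ) : Matrix (Fin n) (Fin n) ℂ :=
  -1 + (2 : ℂ) • Matrix.vecMulVec (coinState n) (star (coinState n))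

/-- The coin oracle `C'` of `f`: it applies to the coin register the coin `-I` at the nodes `x`
with `f x = true`, and the coin `G` at all other nodes. -/
def coinOracle {n : ℕ} (f : Node n → Bool) : Operator n :=
  Matrix.blockDiagonal fun x => if f x = true then -1 else grover n

/-- The neighbour of a basis label: `(d, x) ↦ (d, x ⊕ e_d)`. -/
def move {n : ℕ} (b : Label n) : Label n := (b.1, b.2 + Pi.single b.1 1)

/-- The shift `S = ∑ |d, x ⊕ e_d⟩⟨d, x|`. -/
def shift (n : ℕ) : Operator n := Matrix.of fun b b' => if b = move b' then 1 else 0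

/-- The perturbed walk operator `U' = S · C'`. -/
def walk {n : ℕ} (f : Node n → Bool) : Operator n := shift n * coinOracle f

/-- Born rule: probability of the outcome `b` in a measurement in the basis `|d, x⟩`. -/
def outcomeProb {n : ℕ} (ψ : State n) (b : Label n) : ℝ := ‖ψ b‖ ^ 2

/-- Probability that a measurement in the basis `|d, x⟩` finds the walker at the node `x`. -/
def nodeProb {n : ℕ} (ψ : State n) (x : Node n) : ℝ := ∑ d : Fin n, outcomeProb ψ (d, x)

theorem move_move {n : ℕ} (b : Label n) : move (move b) = b := by
  refine Prod.ext rfl ?_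
  show b.2 + Pi.single b.1 1 + Pi.single b.1 1 = b.2
  funext i
  simp [add_assoc, CharTwo.add_self_eq_zero]

theorem shift_mem_unitaryGroup (n : ℕ) : shift n ∈ Matrix.unitaryGroup (Label n) ℂ := by
  have hstar : star (shift n) = shift n := by
    ext b b'
    have h : b' = move b ↔ b = move b' :=
      ⟨fun h => by rw [h, move_move], fun h => by rw [h, move_move]⟩
    simp only [shift, Matrix.star_apply, Matrix.of_apply, h]
    split_ifs <;> simp
  rw [Matrix.mem_unitaryGroup_iff, hstar]
  ext b b'
  have h : b = move (move b') ↔ b = b' := by rw [move_move]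
  simp only [shift, Matrix.mul_apply, Matrix.of_apply, mul_ite, mul_one, mul_zero,
    Finset.sum_ite_eq', Finset.mem_univ, if_true, h, Matrix.one_apply]

/-- One instruction of a quantum oracle algorithm on the register `|d, x⟩`: a fixed unitary gate
(independent of the oracle), or one call to the coin oracle. -/
inductive Instr (n : ℕ) : Type where
  | gate (V : Matrix.unitaryGroup (Label n) ℂ) : Instr n
  | oracle : Instr n

/-- The operator that an instruction performs when the oracle is that of `f`. -/
def Instr.op {n : ℕ} (f : Node n → Bool) : Instr n → Operator n
  | .gate V => V
  | .oracle => coinOracle f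

/-- The number of oracle calls of an instruction. -/
def Instr.cost {n : ℕ} : Instr n → ℕ
  | .gate _ => 0
  | .oracle => 1

/-- Final state of a program (a list of instructions, the first to be executed first). -/
def run {n : ℕ} (f : Node n → Bool) (A : List (Instr n)) (ψ : State n) : State n :=
  A.foldl (fun φ s => s.op f *ᵥ φ) ψ

/-- Number of oracle calls of a program. -/
def oracleCalls {n : ℕ} (A : List (Instr n)) : ℕ := (A.map Instr.cost).sum

/-- The walk search program: `t` times, call the coin oracle and then shift. It does not depend
on the marked node. -/
def walkSearch (n t : ℕ) : List (Instr n) :=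
  (List.replicate t [Instr.oracle, Instr.gate ⟨shift n, shift_mem_unitaryGroup n⟩]).flatten

/-- The walk search program applies `U' ^ t`. -/
theorem run_walkSearch {n : ℕ} (f : Node n → Bool) (t : ℕ) (ψ : State n) :
    run f (walkSearch n t) ψ = walk f ^ t *ᵥ ψ := by
  induction t generalizing ψ with
  | zero => simp [run, walkSearch]
  | succ t ih =>
    have h : run f (walkSearch n (t + 1)) ψ =
        run f (walkSearch n t) (shift n *ᵥ (coinOracle f *ᵥ ψ)) := by
      simp [run, walkSearch, List.replicate_succ, Instr.op]
    rw [h, ih, pow_succ, Matrix.mulVec_mulVec, Matrix.mulVec_mulVec, walk, Matrix.mul_assoc]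

/-- Classical post-processing of the measurement outcomes of `r` runs: evaluate `f` at the
observed nodes, one after the other, and return the first one with `f x = true`, if any.
This takes at most `r` evaluations of `f`. -/
def searchOutput {n r : ℕ} (f : Node n → Bool) (o : Fin r → Label n) : Option (Node n) :=
  (List.ofFn fun i => (o i).2).find? f

/-- Probability that `r` independent runs of the program `A` from the initial state, each
followed by a measurement in the basis `|d, x⟩`, lead to the output `w`. -/
def repeatedProb {n : ℕ} (f : Node n → Bool) (A : List (Instr n)) (r : ℕ) (w : Node n) : ℝ :=
  ∑ o : Fin r → Label n with searchOutput f o = some w,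
    ∏ i, outcomeProb (run f A (initialState n)) (o i)

/-- Oracle calls of `r` runs of `A` with post-processing: the calls to the coin oracle, and one
evaluation of `f` for each of the `r` observed nodes. -/
def repeatedCalls {n : ℕ} (A : List (Instr n)) (r : ℕ) : ℕ := r * oracleCalls A + r

/-- The (real) number of steps `(π / 2) √(2 ^ (n - 1))`, for `n ≥ 1`. -/
def finalTime (n : ℕ) : ℝ := Real.pi / 2 * √((2 : ℝ) ^ (n - 1))

end HypercubeSearch

end

/-! The function `green δ` solves `⟨green δ⟩_d = (1 - δ) green δ` up to a point source at `0`, where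
`⟨·⟩_d` averages over the neighbours. If `δ` is a root of `green δ 0 = 0`, the walk preserves the
plane spanned by the uniform-coin state with profile `green δ (· - w)` and its shift, and there it
is a rotation by the angle `arccos (1 - δ)`.

Walsh characters diagonalise the neighbour average. Bounding the nonconstant part of `green δ 0` by
the fourth moment of its eigenvalues gives a root with `2 ^ n δ = 1 - O(1/n)`, for which a state
rotating in this plane is within `O(n / √N)` of the initial one. The probability at the marked node
is therefore `sin² (t arccos (1 - δ)) · 2 ^ n δ / (2 - δ)` up to that error, and at `t ≈ t_f` the
angle is `π / 2 + O(1/n)`. -/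

noncomputable section

namespace HypercubeSearch

section General

theorem norm_toLp_mulVec_of_mem_unitaryGroup {ι 𝕜 : Type*} [Fintype ι] [DecidableEq ι] [RCLike 𝕜]
    {M : Matrix ι ι 𝕜} (hM : M ∈ Matrix.unitaryGroup ι 𝕜) (v : ι → 𝕜) :
    ‖WithLp.toLp 2 (M *ᵥ v)‖ = ‖WithLp.toLp 2 v‖ :=
  ContinuousLinearMap.norm_map_of_mem_unitary
    (Unitary.map_mem (Matrix.toEuclideanCLM (n := ι) (𝕜 := 𝕜)) hM) (WithLp.toLp 2 v)

open Polynomial.Chebyshev in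
theorem pow_apply_eq_chebyshev {R V : Type*} [CommRing R] [AddCommGroup V] [Module R V]
    (A : Module.End R V) {v : V} {y : R} (hv : A (A v) = (2 * y) • A v - v) (t : ℕ) :
    (A ^ t) v = (U R (t - 1)).eval y • A v - (U R (t - 2)).eval y • v := by
  induction t with
  | zero => simp
  | succ t ih =>
    have hU : (U R t).eval y = 2 * y * (U R (t - 1)).eval y - (U R (t - 2)).eval y := by
      rw [U_eq R t]
      simp
    rw [pow_succ', Module.End.mul_apply, ih, map_sub, map_smul, map_smul, hv]
    push_cast
    rw [add_sub_cancel_right, show (t : ℤ) + 1 - 2 = t - 1 by ring, hU]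
    module

theorem sum_prod_filter_exists {ι α R : Type*} [Fintype ι] [DecidableEq ι] [Fintype α]
    [CommRing R] {p : α → R} (hp : ∑ a, p a = 1) (P : α → Prop) [DecidablePred P] :
    ∑ o : ι → α with ∃ i, P (o i), ∏ i, p (o i) =
      1 - (1 - ∑ a with P a, p a) ^ Fintype.card ι := by
  have hmiss : ∑ a with ¬P a, p a = 1 - ∑ a with P a, p a := by
    rw [← hp, ← Finset.sum_filter_add_sum_filter_not Finset.univ P, add_sub_cancel_left]
  have htotal : ∑ o : ι → α, ∏ i, p (o i) = 1 := by
    rw [← Fintype.piFinset_univ, Finset.sum_prod_piFinset]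
    simp [hp]
  have hallMiss : ∑ o : ι → α with ¬∃ i, P (o i), ∏ i, p (o i) =
      (1 - ∑ a with P a, p a) ^ Fintype.card ι := by
    have hpi : Finset.univ.filter (fun o : ι → α => ¬∃ i, P (o i)) =
        Fintype.piFinset fun _ => Finset.univ.filter fun a => ¬P a := by
      ext o
      simp
    rw [hpi, Finset.sum_prod_piFinset, hmiss, Finset.prod_const, Finset.card_univ]
  rw [← hallMiss, ← htotal,
    ← Finset.sum_filter_add_sum_filter_not Finset.univ (fun o : ι → α => ∃ i, P (o i)),
    add_sub_cancel_right]

theorem abs_sub_le_two_mul_of_abs_sqrt_sub_sqrt_le {p q ε : ℝ} (hp0 : 0 ≤ p) (hp1 : p ≤ 1)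
    (hq0 : 0 ≤ q) (hq1 : q ≤ 1) (h : |√p - √q| ≤ ε) : |p - q| ≤ 2 * ε := by
  have hsum : √p + √q ≤ 2 := by linarith [Real.sqrt_le_one.2 hp1, Real.sqrt_le_one.2 hq1]
  calc |p - q| = |(√p + √q) * (√p - √q)| := by
        rw [← sq_sub_sq, Real.sq_sqrt hp0, Real.sq_sqrt hq0]
    _ = (√p + √q) * |√p - √q| := by rw [abs_mul, abs_of_nonneg (by positivity)]
    _ ≤ 2 * ε := by gcongr

end General

section Walk

variable {n : ℕ}

theorem coinState_mul_coinState (d d' : Fin n) : coinState n d * coinState n d' = (n : ℂ)⁻¹ := by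
  rw [coinState, coinState, ← Complex.ofReal_mul, div_mul_div_comm, one_mul,
    Real.mul_self_sqrt n.cast_nonneg, one_div, Complex.ofReal_inv, Complex.ofReal_natCast]

theorem star_coinState (n : ℕ) : star (coinState n) = coinState n := by
  funext d
  simp [coinState]

theorem norm_coinState_sq (d : Fin n) : ‖coinState n d‖ ^ 2 = (n : ℝ)⁻¹ := by
  simp [coinState]

theorem isSelfAdjoint_grover (n : ℕ) : IsSelfAdjoint (grover n) := by
  simp [IsSelfAdjoint, grover, Matrix.star_eq_conjTranspose, Matrix.conjTranspose_vecMulVec,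
    star_coinState]

theorem grover_mul_self (n : ℕ) [NeZero n] : grover n * grover n = 1 := by
  have hproj : Matrix.vecMulVec (coinState n) (coinState n) *
      Matrix.vecMulVec (coinState n) (coinState n) =
      Matrix.vecMulVec (coinState n) (coinState n) := by
    rw [Matrix.vecMulVec_mul_vecMulVec]
    simp [dotProduct, coinState_mul_coinState]
  simp only [grover, star_coinState, add_mul, mul_add, smul_mul_assoc, mul_smul_comm, hproj,
    neg_mul, mul_neg, one_mul, mul_one]
  module

theorem coinOracle_mem_unitaryGroup [NeZero n] (f : Node n → Bool) :
    coinOracle f ∈ Matrix.unitaryGroup (Label n) ℂ := by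
  rw [Matrix.mem_unitaryGroup_iff', Matrix.star_eq_conjTranspose, coinOracle,
    Matrix.blockDiagonal_conjTranspose, ← Matrix.blockDiagonal_mul, ← Matrix.blockDiagonal_one]
  congr 1
  funext x
  by_cases hx : f x = true
  · simp [hx]
  · simp [hx, ← Matrix.star_eq_conjTranspose, (isSelfAdjoint_grover n).star_eq, grover_mul_self]

theorem walk_mem_unitaryGroup [NeZero n] (f : Node n → Bool) :
    walk f ∈ Matrix.unitaryGroup (Label n) ℂ :=
  mul_mem (shift_mem_unitaryGroup n) (coinOracle_mem_unitaryGroup f)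

theorem shift_mulVec_apply (ψ : State n) (b : Label n) : (shift n *ᵥ ψ) b = ψ (move b) := by
  have hmove (b' : Label n) : b = move b' ↔ b' = move b :=
    ⟨fun h => by rw [h, move_move], fun h => by rw [h, move_move]⟩
  simp [Matrix.mulVec, dotProduct, shift, hmove]

theorem coinOracle_mulVec_apply (f : Node n → Bool) (ψ : State n) (d : Fin n) (x : Node n) :
    (coinOracle f *ᵥ ψ) (d, x) =
      if f x = true then -ψ (d, x) else 2 * (n : ℂ)⁻¹ * ∑ d', ψ (d', x) - ψ (d, x) := by
  have hblock : (coinOracle f *ᵥ ψ) (d, x) =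
      ∑ d', (if f x = true then -1 else grover n : Matrix (Fin n) (Fin n) ℂ) d d' * ψ (d', x) := by
    simp only [Matrix.mulVec, dotProduct, Fintype.sum_prod_type, coinOracle,
      Matrix.blockDiagonal_apply, ite_mul, zero_mul, Finset.sum_ite_eq, Finset.mem_univ, if_true]
  rw [hblock]
  split_ifs
  · simp [Matrix.one_apply]
  · simp only [grover, star_coinState, Matrix.add_apply, Matrix.neg_apply, Matrix.smul_apply,
      Matrix.vecMulVec_apply, coinState_mul_coinState, add_mul, Finset.sum_add_distrib,
      Finset.mul_sum]
    simp [Matrix.one_apply, sub_eq_neg_add]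

/-- The product state with the coin in equal superposition and with (real) node amplitudes `g`. -/
def uniformCoinState (g : Node n → ℝ) : State n := fun b => coinState n b.1 * (g b.2 : ℂ)

theorem initialState_eq_uniformCoinState (n : ℕ) :
    initialState n = uniformCoinState fun _ => (√(2 ^ n))⁻¹ := by
  simp only [← one_div]
  rfl

theorem norm_toLp_uniformCoinState_sq [NeZero n] (g : Node n → ℝ) :
    ‖WithLp.toLp 2 (uniformCoinState g)‖ ^ 2 = ∑ x, g x ^ 2 := by
  rw [EuclideanSpace.norm_sq_eq, Fintype.sum_prod_type_right]
  simp [uniformCoinState, mul_pow, norm_coinState_sq, mul_inv_cancel_left₀ (NeZero.ne (n : ℝ))]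

theorem norm_toLp_initialState (n : ℕ) [NeZero n] : ‖WithLp.toLp 2 (initialState n)‖ = 1 := by
  rw [← sq_eq_sq₀ (norm_nonneg _) zero_le_one, initialState_eq_uniformCoinState,
    norm_toLp_uniformCoinState_sq]
  simp [ZMod.card]

theorem norm_toLp_walk_pow_mulVec_initialState [NeZero n] (f : Node n → Bool) (t : ℕ) :
    ‖WithLp.toLp 2 (walk f ^ t *ᵥ initialState n)‖ = 1 := by
  rw [norm_toLp_mulVec_of_mem_unitaryGroup (pow_mem (walk_mem_unitaryGroup f) t),
    norm_toLp_initialState]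

theorem walk_mulVec_uniformCoinState [NeZero n] {f : Node n → Bool} {g : Node n → ℝ}
    (hg : ∀ x, f x = true → g x = 0) :
    walk f *ᵥ uniformCoinState g = shift n *ᵥ uniformCoinState g := by
  rw [walk, ← Matrix.mulVec_mulVec]
  congr 1
  funext ⟨d, x⟩
  rw [coinOracle_mulVec_apply]
  split_ifs with hx
  · simp [uniformCoinState, hg x hx]
  · simp only [uniformCoinState, coinState, Finset.sum_const, Finset.card_univ, Fintype.card_fin,
      nsmul_eq_mul]
    field_simp [NeZero.ne (n : ℂ)]
    ring

theorem walk_mulVec_shift_mulVec_uniformCoinState [NeZero n] {f : Node n → Bool}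
    {g : Node n → ℝ} {y : ℝ} (hg : ∀ x, f x = true → g x = 0)
    (hy : ∀ x, f x = false → ∑ d, g (x + Pi.single d 1) = n * (y * g x)) :
    walk f *ᵥ (shift n *ᵥ uniformCoinState g) =
      (2 * y : ℂ) • (shift n *ᵥ uniformCoinState g) - uniformCoinState g := by
  have hcoin : coinOracle f *ᵥ (shift n *ᵥ uniformCoinState g) =
      (2 * y : ℂ) • uniformCoinState g - shift n *ᵥ uniformCoinState g := by
    funext ⟨d, x⟩
    rw [coinOracle_mulVec_apply]
    simp only [Pi.sub_apply, Pi.smul_apply, shift_mulVec_apply, smul_eq_mul]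
    split_ifs with hx
    · simp [uniformCoinState, hg x hx]
    · have hsum : ∑ d', uniformCoinState g (move (d', x)) =
          coinState n d * ((∑ d', g (x + Pi.single d' 1) : ℝ) : ℂ) := by
        simp [uniformCoinState, move, coinState, Finset.mul_sum]
      rw [hsum, hy x (by simpa using hx)]
      simp only [uniformCoinState, move]
      push_cast
      field_simp [NeZero.ne (n : ℂ)]
  have hshift : shift n *ᵥ (shift n *ᵥ uniformCoinState g) = uniformCoinState g := by
    funext b
    rw [shift_mulVec_apply, shift_mulVec_apply, move_move]
  rw [walk, ← Matrix.mulVec_mulVec, hcoin, Matrix.mulVec_sub, Matrix.mulVec_smul, hshift]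

open Polynomial.Chebyshev in
theorem walk_pow_mulVec_uniformCoinState [NeZero n] {f : Node n → Bool} {g : Node n → ℝ} {y : ℝ}
    (hg : ∀ x, f x = true → g x = 0)
    (hy : ∀ x, f x = false → ∑ d, g (x + Pi.single d 1) = n * (y * g x)) (t : ℕ) :
    walk f ^ t *ᵥ uniformCoinState g =
      (((U ℝ (t - 1)).eval y : ℝ) : ℂ) • (shift n *ᵥ uniformCoinState g) -
        (((U ℝ (t - 2)).eval y : ℝ) : ℂ) • uniformCoinState g := by
  have hwalk := walk_mulVec_uniformCoinState hg
  have hrec : (walk f).toLin' ((walk f).toLin' (uniformCoinState g)) =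
      (2 * y : ℂ) • (walk f).toLin' (uniformCoinState g) - uniformCoinState g := by
    simp only [Matrix.toLin'_apply, hwalk]
    exact walk_mulVec_shift_mulVec_uniformCoinState hg hy
  have hpow := pow_apply_eq_chebyshev _ hrec t
  rwa [← Matrix.toLin'_pow, Matrix.toLin'_apply, Matrix.toLin'_apply, hwalk,
    ← complex_ofReal_eval_U, ← complex_ofReal_eval_U] at hpow

end Walk

section Characters

variable {n : ℕ}

/-- The character `a ↦ (-1) ^ a` of `ZMod 2`, with real values. -/
def bitSign : AddChar (ZMod 2) ℝ := AddChar.zmodChar 2 (ζ := -1) (by norm_num)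

theorem bitSign_of_ne_zero {a : ZMod 2} (ha : a ≠ 0) : bitSign a = -1 := by
  have ha1 : a = 1 := Fin.eq_one_of_ne_zero a ha
  rw [ha1, bitSign, AddChar.zmodChar_apply, ZMod.val_one, pow_one]

theorem bitSign_le_one (a : ZMod 2) : bitSign a ≤ 1 := by
  by_cases ha : a = 0
  · rw [ha, AddChar.map_zero_eq_one]
  · rw [bitSign_of_ne_zero ha]
    norm_num

/-- The Walsh character `x ↦ (-1) ^ (k · x)` of the `n`-cube. -/
def walshChar (k : Node n) : AddChar (Node n) ℝ where
  toFun x := ∏ i, bitSign (k i * x i)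
  map_zero_eq_one' := by simp
  map_add_eq_mul' x y := by simp [mul_add, AddChar.map_add_eq_mul, Finset.prod_mul_distrib]

theorem walshChar_apply (k x : Node n) : walshChar k x = ∏ i, bitSign (k i * x i) := rfl

theorem walshChar_comm (k x : Node n) : walshChar k x = walshChar x k := by
  simp only [walshChar_apply, mul_comm]

theorem walshChar_zero_left (x : Node n) : walshChar 0 x = 1 := by
  rw [walshChar_comm, AddChar.map_zero_eq_one]

theorem walshChar_comp_perm (k x : Node n) (σ : Equiv.Perm (Fin n)) :
    walshChar (k ∘ σ) (x ∘ σ) = walshChar k x :=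
  Equiv.prod_comp σ fun i => bitSign (k i * x i)

theorem walshChar_single (k : Node n) (d : Fin n) :
    walshChar k (Pi.single d 1) = bitSign (k d) := by
  rw [walshChar_apply, Fintype.prod_eq_single d fun i hi => by simp [hi], Pi.single_eq_same,
    mul_one]

theorem walshChar_eq_zero_iff (k : Node n) : walshChar k = 0 ↔ k = 0 := by
  refine ⟨fun h => funext fun d => ?_, fun h => ?_⟩
  · have hd : bitSign (k d) = 1 := by rw [← walshChar_single, h, AddChar.zero_apply]
    by_contra hk
    rw [bitSign_of_ne_zero hk] at hd
    norm_num at hd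
  · ext x
    rw [h, walshChar_zero_left, AddChar.zero_apply]

theorem sum_walshChar (x : Node n) : ∑ k, walshChar k x = if x = 0 then (2 : ℝ) ^ n else 0 := by
  simp only [walshChar_comm _ x, AddChar.sum_eq_ite, walshChar_eq_zero_iff]
  simp [ZMod.card]

theorem sum_sq_sum_mul_walshChar (s : Finset (Node n)) (a : Node n → ℝ) :
    ∑ x, (∑ k ∈ s, a k * walshChar k x) ^ 2 = 2 ^ n * ∑ k ∈ s, a k ^ 2 := by
  have horth (k l : Node n) : ∑ x, walshChar k x * walshChar l x = if k = l then 2 ^ n else 0 := by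
    have hkl : k + l = 0 ↔ k = l := by
      simp only [funext_iff, Pi.add_apply, Pi.zero_apply, CharTwo.add_eq_zero]
    simp only [walshChar_comm k, walshChar_comm l, ← AddChar.map_add_eq_mul, sum_walshChar, hkl]
  calc ∑ x, (∑ k ∈ s, a k * walshChar k x) ^ 2
      = ∑ k ∈ s, ∑ l ∈ s, a k * a l * ∑ x, walshChar k x * walshChar l x := by
        simp only [sq, Finset.sum_mul_sum]
        simp only [Finset.mul_sum]
        rw [Finset.sum_comm]
        refine Finset.sum_congr rfl fun k _ => ?_
        rw [Finset.sum_comm]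
        exact Finset.sum_congr rfl fun l _ => Finset.sum_congr rfl fun x _ => by ring
    _ = 2 ^ n * ∑ k ∈ s, a k ^ 2 := by
        simp only [horth, mul_ite, mul_zero, Finset.sum_ite_eq, Finset.mul_sum]
        exact Finset.sum_congr rfl fun k hk => by rw [if_pos hk]; ring

/-- `n - 2 |k|`, where `|k|` is the number of ones of `k`: the eigenvalue of the adjacency operator
of the `n`-cube at the character `k`. -/
def signSum (k : Node n) : ℝ := ∑ i, bitSign (k i)

theorem signSum_zero : signSum (0 : Node n) = n := by
  simp [signSum]

theorem signSum_comp_perm (k : Node n) (σ : Equiv.Perm (Fin n)) : signSum (k ∘ σ) = signSum k :=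
  Equiv.sum_comp σ fun i => bitSign (k i)

theorem signSum_le_of_ne_zero {k : Node n} (hk : k ≠ 0) : signSum k ≤ n - 2 := by
  obtain ⟨d, hd⟩ := Function.ne_iff.1 hk
  have hrest : ∑ i ∈ {d}ᶜ, bitSign (k i) ≤ ∑ i ∈ ({d}ᶜ : Finset (Fin n)), 1 :=
    Finset.sum_le_sum fun i _ => bitSign_le_one (k i)
  have hall : ∑ _ : Fin n, (1 : ℝ) = n := by simp
  rw [Fintype.sum_eq_add_sum_compl d] at hall
  rw [signSum, Fintype.sum_eq_add_sum_compl d, bitSign_of_ne_zero hd]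
  linarith

theorem sum_comp_signSum_succ (φ : ℝ → ℝ) :
    ∑ k : Node (n + 1), φ (signSum k) =
      ∑ k : Node n, φ (signSum k + 1) + ∑ k : Node n, φ (signSum k - 1) := by
  rw [← (Fin.consEquiv fun _ => ZMod 2).sum_comp, Fintype.sum_prod_type]
  simp only [Fin.consEquiv_apply, signSum, Fin.sum_univ_succ, Fin.cons_zero, Fin.cons_succ]
  have hbit (ψ : ZMod 2 → ℝ) : ∑ a, ψ a = ψ 0 + ψ 1 := Fin.sum_univ_two ψ
  simp only [hbit, AddChar.map_zero_eq_one, bitSign_of_ne_zero one_ne_zero, add_comm (1 : ℝ),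
    neg_add_eq_sub]

theorem sum_signSum (n : ℕ) : ∑ k : Node n, signSum k = 0 := by
  induction n with
  | zero => simp [signSum]
  | succ n ih =>
    rw [sum_comp_signSum_succ fun s => s, ← Finset.sum_add_distrib]
    simp only [add_add_sub_cancel, Finset.sum_add_distrib, ih, add_zero]

theorem sum_signSum_sq (n : ℕ) : ∑ k : Node n, signSum k ^ 2 = n * 2 ^ n := by
  induction n with
  | zero => simp [signSum]
  | succ n ih =>
    have hpair (s : ℝ) : (s + 1) ^ 2 + (s - 1) ^ 2 = 2 * s ^ 2 + 2 := by ring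
    rw [sum_comp_signSum_succ fun s => s ^ 2, ← Finset.sum_add_distrib]
    simp only [hpair, Finset.sum_add_distrib, ← Finset.mul_sum, ih, Finset.sum_const,
      Finset.card_univ, Fintype.card_fun, ZMod.card, Fintype.card_fin, nsmul_eq_mul]
    push_cast
    ring

theorem sum_signSum_pow_three (n : ℕ) : ∑ k : Node n, signSum k ^ 3 = 0 := by
  induction n with
  | zero => simp [signSum]
  | succ n ih =>
    have hpair (s : ℝ) : (s + 1) ^ 3 + (s - 1) ^ 3 = 2 * s ^ 3 + 6 * s := by ring
    rw [sum_comp_signSum_succ fun s => s ^ 3, ← Finset.sum_add_distrib]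
    simp only [hpair, Finset.sum_add_distrib, ← Finset.mul_sum, ih, sum_signSum, mul_zero, add_zero]

theorem sum_signSum_pow_four (n : ℕ) :
    ∑ k : Node n, signSum k ^ 4 = (3 * n ^ 2 - 2 * n) * 2 ^ n := by
  induction n with
  | zero => simp [signSum]
  | succ n ih =>
    have hpair (s : ℝ) : (s + 1) ^ 4 + (s - 1) ^ 4 = 2 * s ^ 4 + 12 * s ^ 2 + 2 := by ring
    rw [sum_comp_signSum_succ fun s => s ^ 4, ← Finset.sum_add_distrib]
    simp only [hpair, Finset.sum_add_distrib, ← Finset.mul_sum, ih, sum_signSum_sq,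
      Finset.sum_const, Finset.card_univ, Fintype.card_fun, ZMod.card, Fintype.card_fin,
      nsmul_eq_mul]
    push_cast
    ring

end Characters

section GreenFunction

variable {n : ℕ}

/-- The eigenvalue of the simple random walk step on the `n`-cube at the character `k`. -/
def stepEigenvalue (k : Node n) : ℝ := signSum k / n

theorem stepEigenvalue_zero [NeZero n] : stepEigenvalue (0 : Node n) = 1 := by
  rw [stepEigenvalue, signSum_zero, div_self (NeZero.ne _)]

theorem stepEigenvalue_comp_perm (k : Node n) (σ : Equiv.Perm (Fin n)) :
    stepEigenvalue (k ∘ σ) = stepEigenvalue k := by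
  rw [stepEigenvalue, signSum_comp_perm, stepEigenvalue]

theorem two_div_le_one_sub_stepEigenvalue [NeZero n] {k : Node n} (hk : k ≠ 0) :
    2 / n ≤ 1 - stepEigenvalue k := by
  have hn : (0 : ℝ) < n := Nat.cast_pos.2 (NeZero.pos n)
  rw [stepEigenvalue, one_sub_div hn.ne']
  exact div_le_div_of_nonneg_right (by linarith [signSum_le_of_ne_zero hk]) hn.le

theorem one_div_le_one_sub_sub_stepEigenvalue [NeZero n] {k : Node n} (hk : k ≠ 0) {δ : ℝ}
    (hδ : δ ≤ 1 / n) : 1 / n ≤ 1 - δ - stepEigenvalue k := by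
  have hgap := two_div_le_one_sub_stepEigenvalue hk
  rw [← one_add_one_eq_two, add_div] at hgap
  linarith

/-- The Green function of the simple random walk step `P` on the `n`-cube with its pole at `0`, that
is, the kernel of `(1 - δ - P)⁻¹`, expanded in the Walsh characters. An eigenvalue of `P` equal to
`1 - δ` contributes `0`. -/
def green (δ : ℝ) (x : Node n) : ℝ :=
  ∑ k, (2 ^ n * (1 - δ - stepEigenvalue k))⁻¹ * walshChar k x

/-- The nonconstant part of the Green function, regular at `δ = 0`. -/
def greenTail (δ : ℝ) (x : Node n) : ℝ :=
  ∑ k ∈ {0}ᶜ, (2 ^ n * (1 - δ - stepEigenvalue k))⁻¹ * walshChar k x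

theorem greenTail_zero (δ : ℝ) :
    greenTail δ (0 : Node n) = ∑ k ∈ {0}ᶜ, (2 ^ n * (1 - δ - stepEigenvalue (k : Node n)))⁻¹ := by
  simp only [greenTail, AddChar.map_zero_eq_one, mul_one]

theorem green_eq_greenTail_sub [NeZero n] (δ : ℝ) (x : Node n) :
    green δ x = greenTail δ x - (2 ^ n * δ)⁻¹ := by
  rw [green, Fintype.sum_eq_add_sum_compl 0, stepEigenvalue_zero, walshChar_zero_left, mul_one,
    sub_sub_cancel_left, mul_neg, inv_neg, neg_add_eq_sub, greenTail]

theorem sum_greenTail_sq_le [NeZero n] {δ : ℝ} (hδn : δ ≤ 1 / n) :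
    ∑ x : Node n, greenTail δ x ^ 2 ≤ n ^ 2 := by
  have hn : (0 : ℝ) < n := Nat.cast_pos.2 (NeZero.pos n)
  have hcoeff (k : Node n) (hk : k ∈ ({0}ᶜ : Finset (Node n))) :
      (2 ^ n * (1 - δ - stepEigenvalue k))⁻¹ ^ 2 ≤ (n / 2 ^ n : ℝ) ^ 2 := by
    have hgap := one_div_le_one_sub_sub_stepEigenvalue (by simpa using hk) hδn
    have hpos : 0 < 1 - δ - stepEigenvalue k := (one_div_pos.2 hn).trans_le hgap
    gcongr
    rw [inv_le_comm₀ (by positivity) (by positivity), inv_div, div_eq_mul_one_div]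
    gcongr
  calc ∑ x : Node n, greenTail δ x ^ 2
      = 2 ^ n * ∑ k ∈ {0}ᶜ, (2 ^ n * (1 - δ - stepEigenvalue (k : Node n)))⁻¹ ^ 2 :=
        sum_sq_sum_mul_walshChar _ _
    _ ≤ 2 ^ n * ∑ _ ∈ ({0}ᶜ : Finset (Node n)), (n / 2 ^ n : ℝ) ^ 2 :=
        mul_le_mul_of_nonneg_left (Finset.sum_le_sum hcoeff) (by positivity)
    _ ≤ 2 ^ n * ∑ _ : Node n, (n / 2 ^ n : ℝ) ^ 2 := by
        gcongr
        exact Finset.subset_univ _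
    _ = n ^ 2 := by
        simp only [Finset.sum_const, Finset.card_univ, Fintype.card_fun, ZMod.card,
          Fintype.card_fin, nsmul_eq_mul]
        push_cast
        field_simp

theorem green_comp_perm (δ : ℝ) (x : Node n) (σ : Equiv.Perm (Fin n)) :
    green δ (x ∘ σ) = green δ x := by
  rw [green, ← (σ.symm.arrowCongr (Equiv.refl (ZMod 2))).sum_comp]
  simp [green, Equiv.arrowCongr, walshChar_comp_perm, stepEigenvalue_comp_perm]

theorem sum_green_add_single [NeZero n] {δ : ℝ} (hδ : 0 < δ) (hδn : δ ≤ 1 / n) (x : Node n) :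
    ∑ d, green δ (x + Pi.single d 1) = n * ((1 - δ) * green δ x - if x = 0 then 1 else 0) := by
  have hden (k : Node n) : 1 - δ - stepEigenvalue k ≠ 0 := by
    by_cases hk : k = 0
    · rw [hk, stepEigenvalue_zero]
      linarith
    · have hn : (0 : ℝ) < 1 / n := one_div_pos.2 (Nat.cast_pos.2 (NeZero.pos n))
      exact (hn.trans_le (one_div_le_one_sub_sub_stepEigenvalue hk hδn)).ne'
  have hterm (k : Node n) : n * ((1 - δ) * ((2 ^ n * (1 - δ - stepEigenvalue k))⁻¹ * walshChar k x))
      = ∑ d, (2 ^ n * (1 - δ - stepEigenvalue k))⁻¹ * walshChar k (x + Pi.single d 1) +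
        n * ((2 ^ n)⁻¹ * walshChar k x) := by
    have hs : ∑ d, bitSign (k d) = n * stepEigenvalue k := by
      rw [stepEigenvalue, mul_div_cancel₀ _ (NeZero.ne (n : ℝ)), signSum]
    simp only [AddChar.map_add_eq_mul, walshChar_single, ← Finset.mul_sum]
    have := hden k
    rw [hs]
    field_simp
    ring
  have hdelta : ∑ k, (2 ^ n)⁻¹ * walshChar k x = if x = 0 then 1 else 0 := by
    rw [← Finset.mul_sum, sum_walshChar, mul_ite, mul_zero, inv_mul_cancel₀ (by positivity)]
  simp only [green]
  rw [Finset.sum_comm, ← hdelta, mul_sub, Finset.mul_sum, Finset.mul_sum, Finset.mul_sum,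
    eq_sub_iff_add_eq, ← Finset.sum_add_distrib]
  exact Finset.sum_congr rfl fun k _ => (hterm k).symm

theorem green_single [NeZero n] {δ : ℝ} (hδ : 0 < δ) (hδn : δ ≤ 1 / n)
    (hroot : green δ (0 : Node n) = 0) (d : Fin n) : green δ (Pi.single d 1 : Node n) = -1 := by
  have hsymm (d' : Fin n) : green δ (Pi.single d' 1 : Node n) = green δ (Pi.single d 1) := by
    rw [← green_comp_perm δ (Pi.single d 1) (Equiv.swap d d')]
    rw [Function.comp_def]
    congr 1
    funext i
    simp only [Pi.single_apply, Equiv.swap_apply_eq_iff, Equiv.swap_apply_left]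
  have hsum := sum_green_add_single hδ hδn (0 : Node n)
  simp only [zero_add, hsymm, hroot, Finset.sum_const, Finset.card_univ, Fintype.card_fin,
    nsmul_eq_mul, mul_zero, if_true, zero_sub] at hsum
  exact mul_left_cancel₀ (NeZero.ne (n : ℝ)) hsum

end GreenFunction

section TailBounds

variable {n : ℕ}

theorem geom_sum_four_le_inv_one_sub {c : ℝ} (hc : c < 1) :
    1 + c + c ^ 2 + c ^ 3 ≤ (1 - c)⁻¹ := by
  rw [← one_div, le_div_iff₀ (sub_pos.2 hc)]
  linarith [show (1 + c + c ^ 2 + c ^ 3) * (1 - c) + c ^ 4 = 1 by ring,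
    show 0 ≤ c ^ 4 by positivity]

theorem inv_one_sub_le_geom_sum_four_add {c g : ℝ} (hg : 0 < g) (hc : g ≤ 1 - c) :
    (1 - c)⁻¹ ≤ 1 + c + c ^ 2 + c ^ 3 + c ^ 4 / g := by
  have hpos : 0 < 1 - c := hg.trans_le hc
  calc (1 - c)⁻¹ = 1 + c + c ^ 2 + c ^ 3 + c ^ 4 / (1 - c) := by
        field_simp
        ring
    _ ≤ 1 + c + c ^ 2 + c ^ 3 + c ^ 4 / g := by gcongr

theorem inv_one_sub_sub_le [NeZero n] {k : Node n} (hk : k ≠ 0) {δ : ℝ} (hδ : 0 ≤ δ)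
    (hδn : δ ≤ 1 / n) :
    (1 - δ - stepEigenvalue k)⁻¹ ≤ (1 + n * δ) * (1 - stepEigenvalue k)⁻¹ := by
  have hn : (0 : ℝ) < n := Nat.cast_pos.2 (NeZero.pos n)
  have hgap := one_div_le_one_sub_sub_stepEigenvalue hk hδn
  have hpos : 0 < 1 - δ - stepEigenvalue k := (one_div_pos.2 hn).trans_le hgap
  have hfactor : δ * 1 ≤ δ * (n * (1 - δ - stepEigenvalue k)) :=
    mul_le_mul_of_nonneg_left ((div_le_iff₀' hn).1 hgap) hδ
  rw [← one_div, ← div_eq_mul_inv, div_le_div_iff₀ hpos (by linarith)]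
  linarith

theorem sum_geom_sum_four_stepEigenvalue (n : ℕ) [NeZero n] :
    ∑ k : Node n, (1 + stepEigenvalue k + stepEigenvalue k ^ 2 + stepEigenvalue k ^ 3) =
      (2 : ℝ) ^ n * (1 + 1 / n) := by
  have hn := NeZero.ne (n : ℝ)
  simp only [stepEigenvalue, div_pow, Finset.sum_add_distrib, ← Finset.sum_div, sum_signSum,
    sum_signSum_sq, sum_signSum_pow_three, Finset.sum_const, Finset.card_univ, Fintype.card_fun,
    ZMod.card, Fintype.card_fin, nsmul_eq_mul]
  push_cast
  field_simp
  ring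

theorem sum_stepEigenvalue_pow_four_le (n : ℕ) :
    ∑ k : Node n, stepEigenvalue k ^ 4 ≤ 2 ^ n * (3 / n ^ 2) := by
  obtain rfl | hn := n.eq_zero_or_pos
  · simp [stepEigenvalue]
  simp only [stepEigenvalue, div_pow, ← Finset.sum_div, sum_signSum_pow_four]
  rw [div_le_iff₀ (by positivity)]
  field_simp
  nlinarith [show (0 : ℝ) < 2 ^ n by positivity]

theorem le_greenTail_zero [NeZero n] {δ : ℝ} (hδ : 0 ≤ δ) (hδn : δ ≤ 1 / n) :
    1 + 1 / n - 4 / 2 ^ n ≤ greenTail δ (0 : Node n) := by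
  have hterm (k : Node n) (hk : k ∈ ({0}ᶜ : Finset (Node n))) :
      (2 ^ n)⁻¹ * (1 + stepEigenvalue k + stepEigenvalue k ^ 2 + stepEigenvalue k ^ 3) ≤
        (2 ^ n * (1 - δ - stepEigenvalue k))⁻¹ := by
    have hgap := one_div_le_one_sub_sub_stepEigenvalue (by simpa using hk) hδn
    have hpos : 0 < 1 - δ - stepEigenvalue k :=
      (one_div_pos.2 (Nat.cast_pos.2 (NeZero.pos n))).trans_le hgap
    rw [mul_inv]
    gcongr
    exact (geom_sum_four_le_inv_one_sub (by linarith)).trans (inv_anti₀ hpos (by linarith))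
  have hsum := sum_geom_sum_four_stepEigenvalue n
  rw [Fintype.sum_eq_add_sum_compl 0, stepEigenvalue_zero] at hsum
  rw [greenTail_zero]
  refine le_trans (le_of_eq ?_) (Finset.sum_le_sum hterm)
  rw [← Finset.mul_sum, eq_sub_of_add_eq' hsum]
  field_simp
  ring

theorem greenTail_zero_le [NeZero n] {δ : ℝ} (hδ : 0 ≤ δ) (hδn : δ ≤ 1 / n) :
    greenTail δ (0 : Node n) ≤ (1 + n * δ) * (1 + 5 / (2 * n)) := by
  have hn : (0 : ℝ) < n := Nat.cast_pos.2 (NeZero.pos n)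
  let b (k : Node n) : ℝ := 1 + stepEigenvalue k + stepEigenvalue k ^ 2 + stepEigenvalue k ^ 3 +
    stepEigenvalue k ^ 4 / (2 / n)
  have hterm (k : Node n) (hk : k ∈ ({0}ᶜ : Finset (Node n))) :
      (2 ^ n * (1 - δ - stepEigenvalue k))⁻¹ ≤ (2 ^ n)⁻¹ * ((1 + n * δ) * b k) := by
    have hk0 : k ≠ 0 := by simpa using hk
    rw [mul_inv]
    gcongr
    refine (inv_one_sub_sub_le hk0 hδ hδn).trans ?_
    gcongr
    exact inv_one_sub_le_geom_sum_four_add (by positivity) (two_div_le_one_sub_stepEigenvalue hk0)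
  have hconst : 0 ≤ b 0 := by
    simp only [b, stepEigenvalue_zero]
    positivity
  have hb : ∑ k ∈ {0}ᶜ, b k ≤ 2 ^ n * (1 + 5 / (2 * n)) := by
    calc ∑ k ∈ {0}ᶜ, b k ≤ ∑ k, b k := by
          rw [Fintype.sum_eq_add_sum_compl 0]
          linarith
      _ ≤ 2 ^ n * (1 + 1 / n) + 2 ^ n * (3 / n ^ 2) / (2 / n) := by
          simp only [b]
          rw [Finset.sum_add_distrib, sum_geom_sum_four_stepEigenvalue, ← Finset.sum_div]
          gcongr
          exact sum_stepEigenvalue_pow_four_le n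
      _ = 2 ^ n * (1 + 5 / (2 * n)) := by
          field_simp
          ring
  calc greenTail δ (0 : Node n) ≤ ∑ k ∈ {0}ᶜ, (2 ^ n)⁻¹ * ((1 + n * δ) * b k) := by
        rw [greenTail_zero]
        exact Finset.sum_le_sum hterm
    _ = (2 ^ n)⁻¹ * ((1 + n * δ) * ∑ k ∈ {0}ᶜ, b k) := by rw [Finset.mul_sum, Finset.mul_sum]
    _ ≤ (2 ^ n)⁻¹ * ((1 + n * δ) * (2 ^ n * (1 + 5 / (2 * n)))) := by gcongr
    _ = (1 + n * δ) * (1 + 5 / (2 * n)) := by field_simp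

theorem continuousOn_greenTail_zero (n : ℕ) [NeZero n] :
    ContinuousOn (fun δ => greenTail δ (0 : Node n)) (Set.Icc 0 (1 / n)) := by
  simp only [greenTail_zero]
  refine continuousOn_finsetSum _ fun k hk => ContinuousOn.inv₀ (by fun_prop) fun δ hδ => ?_
  have hgap := one_div_le_one_sub_sub_stepEigenvalue (by simpa using hk) hδ.2
  have hpos := (one_div_pos.2 (Nat.cast_pos.2 (NeZero.pos n))).trans_le hgap
  positivity

theorem one_add_le_greenTail_zero [NeZero n] (hn : 100 * (n : ℝ) ^ 2 ≤ 2 ^ n) {δ : ℝ} (hδ : 0 ≤ δ)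
    (hδn : δ ≤ 1 / n) : 1 + 24 / (25 * n) ≤ greenTail δ (0 : Node n) := by
  have hn1 : (1 : ℝ) ≤ n := Nat.one_le_cast.2 NeZero.one_le
  have hN : (4 / 2 ^ n : ℝ) ≤ 1 / (25 * n) := by
    rw [div_le_div_iff₀ (by positivity) (by positivity)]
    nlinarith
  calc (1 + 24 / (25 * n) : ℝ) = 1 + 1 / n - 1 / (25 * n) := by
        field_simp
        ring
    _ ≤ 1 + 1 / n - 4 / 2 ^ n := by gcongr
    _ ≤ greenTail δ (0 : Node n) := le_greenTail_zero hδ hδn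

theorem one_div_two_pow_le_one_div [NeZero n] (hn : 100 * (n : ℝ) ^ 2 ≤ 2 ^ n) :
    (1 / 2 ^ n : ℝ) ≤ 1 / n := by
  have hn1 : (1 : ℝ) ≤ n := Nat.one_le_cast.2 NeZero.one_le
  exact one_div_le_one_div_of_le (by positivity) (by nlinarith)

theorem greenTail_zero_le_one_add [NeZero n] (hn : 100 * (n : ℝ) ^ 2 ≤ 2 ^ n) {δ : ℝ} (hδ : 0 ≤ δ)
    (hδN : δ ≤ 1 / 2 ^ n) : greenTail δ (0 : Node n) ≤ 1 + 3 / n := by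
  have hn1 : (1 : ℝ) ≤ n := Nat.one_le_cast.2 NeZero.one_le
  have hnδ : n * δ ≤ 1 / (100 * n) := by
    calc n * δ ≤ n * (1 / 2 ^ n) := by gcongr
      _ ≤ n * (1 / (100 * n ^ 2)) := by gcongr
      _ = 1 / (100 * n) := by field_simp
  calc greenTail δ (0 : Node n) ≤ (1 + n * δ) * (1 + 5 / (2 * n)) :=
        greenTail_zero_le hδ (hδN.trans (one_div_two_pow_le_one_div hn))
    _ ≤ (1 + 1 / (100 * n)) * (1 + 5 / (2 * n)) := by gcongr
    _ ≤ 1 + 3 / n := by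
        field_simp
        nlinarith

theorem exists_mul_greenTail_zero_eq_one [NeZero n] (hn : 100 * (n : ℝ) ^ 2 ≤ 2 ^ n) :
    ∃ δ : ℝ, 0 ≤ δ ∧ δ ≤ 1 / 2 ^ n ∧ 2 ^ n * δ * greenTail δ (0 : Node n) = 1 := by
  have hNn := one_div_two_pow_le_one_div hn
  have hcont : ContinuousOn (fun δ => 2 ^ n * δ * greenTail δ (0 : Node n))
      (Set.Icc 0 (1 / 2 ^ n)) :=
    (by fun_prop : Continuous fun δ : ℝ => 2 ^ n * δ).continuousOn.mul
      ((continuousOn_greenTail_zero n).mono (Set.Icc_subset_Icc_right hNn))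
  have hright : 1 ≤ 2 ^ n * (1 / 2 ^ n) * greenTail (1 / 2 ^ n) (0 : Node n) := by
    rw [mul_one_div_cancel (by positivity), one_mul]
    exact (le_add_of_nonneg_right (by positivity)).trans
      (one_add_le_greenTail_zero hn (by positivity) hNn)
  obtain ⟨δ, ⟨hδ0, hδN⟩, hδ⟩ :=
    intermediate_value_Icc (by positivity) hcont ⟨by norm_num, hright⟩
  exact ⟨δ, hδ0, hδN, hδ⟩

theorem exists_green_zero_eq_zero [NeZero n] (hn : 100 * (n : ℝ) ^ 2 ≤ 2 ^ n) :
    ∃ δ : ℝ, 0 < δ ∧ green δ (0 : Node n) = 0 ∧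
      1 - 3 / n ≤ 2 ^ n * δ ∧ 2 ^ n * δ ≤ 1 - 1 / (4 * n) := by
  obtain ⟨δ, hδ0, hδN, hδ⟩ := exists_mul_greenTail_zero_eq_one hn
  have hn1 : (1 : ℝ) ≤ n := Nat.one_le_cast.2 NeZero.one_le
  have hlower := one_add_le_greenTail_zero hn hδ0 (hδN.trans (one_div_two_pow_le_one_div hn))
  have hupper := greenTail_zero_le_one_add hn hδ0 hδN
  have htail : 0 < greenTail δ (0 : Node n) := lt_of_lt_of_le (by positivity) hlower
  have hmass : 2 ^ n * δ = 1 / greenTail δ (0 : Node n) := eq_one_div_of_mul_eq_one_left hδ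
  have hδpos : 0 < δ := pos_of_mul_pos_right (hmass ▸ one_div_pos.2 htail) (by positivity)
  refine ⟨δ, hδpos, ?_, ?_, ?_⟩
  · rw [green_eq_greenTail_sub, hmass, one_div, inv_inv, sub_self]
  · calc (1 - 3 / n : ℝ) ≤ 1 / (1 + 3 / n) := by
          rw [le_div_iff₀ (by positivity)]
          nlinarith [sq_nonneg (3 / n : ℝ)]
      _ ≤ 2 ^ n * δ := hmass ▸ one_div_le_one_div_of_le htail hupper
  · calc 2 ^ n * δ ≤ 1 / (1 + 24 / (25 * n)) :=
          hmass ▸ one_div_le_one_div_of_le (by positivity) hlower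
      _ ≤ 1 - 1 / (4 * n) := by
          field_simp
          nlinarith

end TailBounds

section RotatingState

variable {n : ℕ}

/-- Node amplitudes which vanish at the marked node `w` when `green δ 0 = 0`. The walk rotates the
corresponding state of `uniformCoinState` in a plane, by the angle `arccos (1 - δ)` per step. The
normalization makes the constant Fourier mode agree with that of the initial state. -/
def rotatingProfile (δ : ℝ) (w x : Node n) : ℝ := -(δ * √(2 ^ n)) * green δ (x - w)

theorem sum_rotatingProfile_add_single [NeZero n] {δ : ℝ} (hδ : 0 < δ) (hδn : δ ≤ 1 / n)
    {w x : Node n} (hx : x ≠ w) :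
    ∑ d, rotatingProfile δ w (x + Pi.single d 1) = n * ((1 - δ) * rotatingProfile δ w x) := by
  simp only [rotatingProfile, ← Finset.mul_sum, add_sub_right_comm]
  rw [sum_green_add_single hδ hδn, if_neg (sub_ne_zero.2 hx)]
  ring

open Polynomial.Chebyshev in
theorem nodeProb_walk_pow_mulVec_rotatingProfile [NeZero n] {f : Node n → Bool} {w : Node n}
    (hf : ∀ x, f x = true ↔ x = w) {δ : ℝ} (hδ : 0 < δ) (hδn : δ ≤ 1 / n)
    (hroot : green δ (0 : Node n) = 0) (t : ℕ) :
    nodeProb (walk f ^ t *ᵥ uniformCoinState (rotatingProfile δ w)) w =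
      ((U ℝ (t - 1)).eval (1 - δ) * (δ * √(2 ^ n))) ^ 2 := by
  have hmarked : rotatingProfile δ w w = 0 := by
    rw [rotatingProfile, sub_self, hroot, mul_zero]
  have hnext (d : Fin n) : rotatingProfile δ w (w + Pi.single d 1) = δ * √(2 ^ n) := by
    rw [rotatingProfile, add_sub_cancel_left, green_single hδ hδn hroot]
    ring
  have hy (x : Node n) (hx : f x = false) := sum_rotatingProfile_add_single hδ hδn
    (w := w) (x := x) (by simpa [hx] using (hf x).not)
  have hamp (d : Fin n) :
      (walk f ^ t *ᵥ uniformCoinState (rotatingProfile δ w)) (d, w) =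
        coinState n d * (((U ℝ (t - 1)).eval (1 - δ) * (δ * √(2 ^ n)) : ℝ) : ℂ) := by
    rw [walk_pow_mulVec_uniformCoinState (fun x hx => (hf x).1 hx ▸ hmarked) hy]
    simp only [Pi.sub_apply, Pi.smul_apply, shift_mulVec_apply, uniformCoinState, move, hmarked,
      hnext, smul_eq_mul, Complex.ofReal_zero, mul_zero, sub_zero]
    push_cast
    ring
  simp only [nodeProb, outcomeProb, hamp, norm_mul, mul_pow, norm_coinState_sq, Complex.norm_real,
    Real.norm_eq_abs, sq_abs, Finset.sum_const, Finset.card_univ, Fintype.card_fin, nsmul_eq_mul]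
  rw [mul_inv_cancel_left₀ (NeZero.ne (n : ℝ))]

open Polynomial.Chebyshev in
theorem nodeProb_walk_pow_mulVec_rotatingProfile_eq_sin_sq [NeZero n] {f : Node n → Bool}
    {w : Node n} (hf : ∀ x, f x = true ↔ x = w) {δ : ℝ} (hδ : 0 < δ) (hδn : δ ≤ 1 / n)
    (hroot : green δ (0 : Node n) = 0) (t : ℕ) :
    nodeProb (walk f ^ t *ᵥ uniformCoinState (rotatingProfile δ w)) w =
      Real.sin (t * Real.arccos (1 - δ)) ^ 2 * (2 ^ n * δ / (2 - δ)) := by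
  have hδ1 : δ ≤ 1 := hδn.trans (div_le_one_of_le₀ (Nat.one_le_cast.2 NeZero.one_le) n.cast_nonneg)
  have hcos : Real.cos (Real.arccos (1 - δ)) = 1 - δ :=
    Real.cos_arccos (by linarith) (by linarith)
  have hsin : Real.sin (Real.arccos (1 - δ)) ^ 2 = δ * (2 - δ) := by
    rw [Real.sin_sq, hcos]
    ring
  have hU := U_real_cos (Real.arccos (1 - δ)) (t - 1)
  rw [hcos] at hU
  push_cast at hU
  rw [sub_add_cancel] at hU
  rw [nodeProb_walk_pow_mulVec_rotatingProfile hf hδ hδn hroot, ← hU, mul_pow, mul_pow, mul_pow,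
    hsin, Real.sq_sqrt (by positivity)]
  have : 2 - δ ≠ 0 := by linarith
  field_simp

theorem inv_sqrt_sub_rotatingProfile [NeZero n] {δ : ℝ} (hδ : δ ≠ 0) (w x : Node n) :
    (√(2 ^ n))⁻¹ - rotatingProfile δ w x = δ * √(2 ^ n) * greenTail δ (x - w) := by
  have hconst : δ * √(2 ^ n) * (2 ^ n * δ)⁻¹ = (√(2 ^ n))⁻¹ := by
    rw [mul_inv, ← Real.sqrt_div_self]
    field_simp
  rw [rotatingProfile, green_eq_greenTail_sub, ← hconst]
  ring

theorem norm_toLp_initialState_sub_rotatingProfile_le [NeZero n] {δ : ℝ} (hδ : 0 < δ)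
    (hδn : δ ≤ 1 / n) (w : Node n) :
    ‖WithLp.toLp 2 (initialState n - uniformCoinState (rotatingProfile δ w))‖ ≤
      δ * √(2 ^ n) * n := by
  have hsub : initialState n - uniformCoinState (rotatingProfile δ w) =
      uniformCoinState fun x => δ * √(2 ^ n) * greenTail δ (x - w) := by
    rw [initialState_eq_uniformCoinState]
    funext b
    simp only [← inv_sqrt_sub_rotatingProfile hδ.ne', Pi.sub_apply, uniformCoinState]
    push_cast
    ring
  have htranslate : ∑ x, greenTail δ (x - w) ^ 2 = ∑ x, greenTail δ x ^ 2 :=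
    (Equiv.subRight w).sum_comp fun x => greenTail δ x ^ 2
  rw [hsub, ← sq_le_sq₀ (norm_nonneg _) (by positivity), norm_toLp_uniformCoinState_sq]
  simp only [mul_pow _ (greenTail _ _), ← Finset.mul_sum, htranslate]
  rw [mul_pow _ (n : ℝ)]
  gcongr
  exact sum_greenTail_sq_le hδn

end RotatingState

section Probability

variable {n : ℕ}

theorem sum_nodeProb (ψ : State n) : ∑ x, nodeProb ψ x = ‖WithLp.toLp 2 ψ‖ ^ 2 := by
  rw [EuclideanSpace.norm_sq_eq, Fintype.sum_prod_type_right]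
  rfl

theorem nodeProb_nonneg (ψ : State n) (x : Node n) : 0 ≤ nodeProb ψ x :=
  Finset.sum_nonneg fun _ _ => sq_nonneg _

theorem nodeProb_le_norm_toLp_sq (ψ : State n) (x : Node n) :
    nodeProb ψ x ≤ ‖WithLp.toLp 2 ψ‖ ^ 2 := by
  rw [← sum_nodeProb]
  exact Finset.single_le_sum (fun y _ => nodeProb_nonneg ψ y) (Finset.mem_univ x)

theorem abs_sqrt_nodeProb_sub_le (ψ φ : State n) (x : Node n) :
    |√(nodeProb ψ x) - √(nodeProb φ x)| ≤ ‖WithLp.toLp 2 (ψ - φ)‖ := by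
  have hsqrt (χ : State n) : √(nodeProb χ x) = ‖WithLp.toLp 2 fun d => χ (d, x)‖ := by
    rw [EuclideanSpace.norm_eq]
    rfl
  calc |√(nodeProb ψ x) - √(nodeProb φ x)|
      ≤ ‖WithLp.toLp 2 (fun d => ψ (d, x)) - WithLp.toLp 2 fun d => φ (d, x)‖ := by
        rw [hsqrt, hsqrt]
        exact abs_norm_sub_norm_le _ _
    _ = √(nodeProb (ψ - φ) x) := by
        rw [hsqrt]
        rfl
    _ ≤ ‖WithLp.toLp 2 (ψ - φ)‖ :=
        Real.sqrt_le_iff.2 ⟨norm_nonneg _, nodeProb_le_norm_toLp_sq _ x⟩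

theorem abs_nodeProb_walk_pow_initialState_sub_le [NeZero n] {f : Node n → Bool}
    {w : Node n} (hf : ∀ x, f x = true ↔ x = w) {δ : ℝ} (hδ : 0 < δ) (hδn : δ ≤ 1 / n)
    (hδN : 2 ^ n * δ ≤ 1) (hroot : green δ (0 : Node n) = 0) (t : ℕ) :
    |nodeProb (walk f ^ t *ᵥ initialState n) w -
      Real.sin (t * Real.arccos (1 - δ)) ^ 2 * (2 ^ n * δ / (2 - δ))| ≤ 2 * (δ * √(2 ^ n) * n) := by
  have hδ1 : δ ≤ 1 := hδn.trans (div_le_one_of_le₀ (Nat.one_le_cast.2 NeZero.one_le) n.cast_nonneg)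
  have hle : nodeProb (walk f ^ t *ᵥ uniformCoinState (rotatingProfile δ w)) w ≤ 1 := by
    rw [nodeProb_walk_pow_mulVec_rotatingProfile_eq_sin_sq hf hδ hδn hroot]
    refine mul_le_one₀ (Real.sin_sq_le_one _) (div_nonneg (by positivity) (by linarith)) ?_
    rw [div_le_one (by linarith)]
    linarith
  rw [← nodeProb_walk_pow_mulVec_rotatingProfile_eq_sin_sq hf hδ hδn hroot]
  refine abs_sub_le_two_mul_of_abs_sqrt_sub_sqrt_le (nodeProb_nonneg _ w) ?_
    (nodeProb_nonneg _ w) hle ((abs_sqrt_nodeProb_sub_le _ _ w).trans ?_)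
  · exact (nodeProb_le_norm_toLp_sq _ w).trans
      (by rw [norm_toLp_walk_pow_mulVec_initialState, one_pow])
  · rw [← Matrix.mulVec_sub, norm_toLp_mulVec_of_mem_unitaryGroup
      (pow_mem (walk_mem_unitaryGroup f) t)]
    exact norm_toLp_initialState_sub_rotatingProfile_le hδ hδn w

end Probability

section Angle

theorem arccos_one_sub_sq_le {δ : ℝ} (hδ0 : 0 ≤ δ) (hδ2 : δ ≤ 2) :
    Real.arccos (1 - δ) ^ 2 ≤ 5 * δ := by
  have hcos : Real.cos (Real.arccos (1 - δ)) = 1 - δ :=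
    Real.cos_arccos (by linarith) (by linarith)
  have hquad := Real.cos_le_one_sub_mul_cos_sq
    (abs_le.2 ⟨by linarith [Real.pi_pos, Real.arccos_nonneg (1 - δ)], Real.arccos_le_pi (1 - δ)⟩)
  have hpi : Real.pi ^ 2 ≤ 10 := by nlinarith [Real.pi_lt_d2, Real.pi_pos]
  rw [hcos, sub_le_sub_iff_left, div_mul_eq_mul_div, div_le_iff₀ (by positivity)] at hquad
  nlinarith

theorem sqrt_two_mul_le_arccos_one_sub {δ : ℝ} (hδ0 : 0 ≤ δ) (hδ2 : δ ≤ 2) :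
    √(2 * δ) ≤ Real.arccos (1 - δ) := by
  have hcos : Real.cos (Real.arccos (1 - δ)) = 1 - δ :=
    Real.cos_arccos (by linarith) (by linarith)
  have hquad := Real.one_sub_sq_div_two_le_cos (x := Real.arccos (1 - δ))
  exact Real.sqrt_le_iff.2 ⟨Real.arccos_nonneg _, by linarith⟩

theorem arccos_one_sub_le {δ : ℝ} (hδ0 : 0 ≤ δ) (hδ2 : δ ≤ 2) :
    Real.arccos (1 - δ) ≤ (1 + δ) * √(2 * δ) := by
  set θ := Real.arccos (1 - δ)
  have hθ0 : 0 ≤ θ := Real.arccos_nonneg _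
  have hθsq : θ ^ 2 ≤ 5 * δ := arccos_one_sub_sq_le hδ0 (by linarith)
  have hhalf : √(2 * δ) = 2 * Real.sin (θ / 2) := by
    have hcos : Real.cos θ = 1 - δ := Real.cos_arccos (by linarith) (by linarith)
    have hsin : 0 ≤ Real.sin (θ / 2) :=
      Real.sin_nonneg_of_nonneg_of_le_pi (by linarith) (by linarith [Real.arccos_le_pi (1 - δ)])
    rw [Real.sqrt_eq_iff_mul_self_eq (by positivity) (by positivity)]
    have hdouble := Real.cos_sq' (θ / 2)
    rw [Real.cos_sq, mul_div_cancel₀ θ two_ne_zero, hcos] at hdouble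
    linarith
  have hcube : θ / 2 - (θ / 2) ^ 3 / 6 ≤ Real.sin (θ / 2) :=
    Real.sin_ge_sub_cube (by positivity)
  calc θ ≤ (1 + δ) * (1 - 5 * δ / 24) * θ := by
        refine le_mul_of_one_le_left hθ0 ?_
        nlinarith
    _ ≤ (1 + δ) * (1 - θ ^ 2 / 24) * θ := by gcongr
    _ = (1 + δ) * (2 * (θ / 2 - (θ / 2) ^ 3 / 6)) := by ring
    _ ≤ (1 + δ) * √(2 * δ) := by
        rw [hhalf]
        gcongr

theorem one_sub_sq_le_sin_sq (x : ℝ) : 1 - (x - Real.pi / 2) ^ 2 ≤ Real.sin x ^ 2 := by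
  rw [← Real.cos_sub_pi_div_two, Real.cos_sq', sub_le_sub_iff_left]
  exact Real.sin_sq_le_sq

theorem finalTime_mul_sqrt (n : ℕ) [NeZero n] (δ : ℝ) :
    finalTime n * √(2 * δ) = Real.pi / 2 * √(2 ^ n * δ) := by
  rw [finalTime, mul_assoc, ← Real.sqrt_mul (by positivity), ← mul_assoc (2 ^ (n - 1) : ℝ),
    pow_sub_one_mul (NeZero.ne n)]

theorem finalTime_nonneg (n : ℕ) : 0 ≤ finalTime n := by
  rw [finalTime]
  positivity

theorem le_one_of_two_pow_mul_le_one {n : ℕ} {δ : ℝ} (hδ : 2 ^ n * δ ≤ 1) : δ ≤ 1 := by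
  by_contra! h
  have hpow : (1 : ℝ) ≤ 2 ^ n := one_le_pow₀ one_le_two
  nlinarith

theorem pi_div_two_mul_le_finalTime_mul_arccos {n : ℕ} [NeZero n] {δ : ℝ} (hδ0 : 0 ≤ δ)
    (hδ : 2 ^ n * δ ≤ 1) :
    Real.pi / 2 * (2 ^ n * δ) ≤ finalTime n * Real.arccos (1 - δ) := by
  have hδ1 := le_one_of_two_pow_mul_le_one hδ
  calc Real.pi / 2 * (2 ^ n * δ) ≤ Real.pi / 2 * √(2 ^ n * δ) := by
        gcongr
        exact Real.le_sqrt_self_iff.2 hδ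
    _ = finalTime n * √(2 * δ) := (finalTime_mul_sqrt n δ).symm
    _ ≤ finalTime n * Real.arccos (1 - δ) :=
        mul_le_mul_of_nonneg_left (sqrt_two_mul_le_arccos_one_sub hδ0 (by linarith))
          (finalTime_nonneg n)

theorem finalTime_mul_arccos_le {n : ℕ} [NeZero n] {δ : ℝ} (hδ0 : 0 ≤ δ) (hδ : 2 ^ n * δ ≤ 1) :
    finalTime n * Real.arccos (1 - δ) ≤ Real.pi / 2 * (1 + δ) := by
  have hδ1 := le_one_of_two_pow_mul_le_one hδ
  calc finalTime n * Real.arccos (1 - δ) ≤ finalTime n * ((1 + δ) * √(2 * δ)) :=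
        mul_le_mul_of_nonneg_left (arccos_one_sub_le hδ0 (by linarith)) (finalTime_nonneg n)
    _ = Real.pi / 2 * √(2 ^ n * δ) * (1 + δ) := by
        rw [← finalTime_mul_sqrt]
        ring
    _ ≤ Real.pi / 2 * 1 * (1 + δ) := by
        gcongr
        exact Real.sqrt_le_one.2 hδ
    _ = Real.pi / 2 * (1 + δ) := by rw [mul_one]

theorem abs_mul_arccos_sub_pi_div_two_le {n : ℕ} [NeZero n] (hn : 100 * (n : ℝ) ^ 2 ≤ 2 ^ n)
    {δ : ℝ} (hδ0 : 0 ≤ δ) (hlower : 1 - 3 / n ≤ 2 ^ n * δ) (hupper : 2 ^ n * δ ≤ 1) {t : ℝ}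
    (ht : |t - finalTime n| ≤ 1) :
    |t * Real.arccos (1 - δ) - Real.pi / 2| ≤ 6 / n := by
  have hn1 : (1 : ℝ) ≤ n := Nat.one_le_cast.2 NeZero.one_le
  have hδsq : 100 * (n ^ 2 * δ) ≤ 1 := by nlinarith
  have hδn : 100 * (n * δ) ≤ 1 := by nlinarith [mul_nonneg (n.cast_nonneg (α := ℝ)) hδ0]
  set θ := Real.arccos (1 - δ)
  set T := finalTime n
  have hθ0 : 0 ≤ θ := Real.arccos_nonneg _
  have hθ : θ ≤ 1 / n := by
    have hθsq : θ ^ 2 ≤ 5 * δ := arccos_one_sub_sq_le hδ0 (by nlinarith)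
    rw [le_div_iff₀ (by positivity), ← sq_le_one_iff₀ (by positivity)]
    nlinarith
  have hTθ : |T * θ - Real.pi / 2| ≤ 5 / n := by
    have hleft : Real.pi / 2 * (1 - 3 / n) ≤ T * θ :=
      (mul_le_mul_of_nonneg_left hlower (by positivity)).trans
        (pi_div_two_mul_le_finalTime_mul_arccos hδ0 hupper)
    have hright : T * θ ≤ Real.pi / 2 * (1 + 3 / n) := by
      refine (finalTime_mul_arccos_le hδ0 hupper).trans ?_
      gcongr
      rw [le_div_iff₀ (by positivity)]
      linarith
    have hpi : Real.pi / 2 * (3 / n) ≤ 5 / n := by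
      rw [mul_div_assoc', div_le_div_iff_of_pos_right (by positivity)]
      linarith [Real.pi_lt_d2]
    rw [abs_le]
    constructor <;> linarith
  have hround : |(t - T) * θ| ≤ 1 / n := by
    rw [abs_mul, abs_of_nonneg hθ0, ← one_mul (1 / (n : ℝ))]
    gcongr
  calc |t * θ - Real.pi / 2| = |(t - T) * θ + (T * θ - Real.pi / 2)| := by ring_nf
    _ ≤ 1 / n + 5 / n := (abs_add_le _ _).trans (add_le_add hround hTθ)
    _ = 6 / n := by ring

theorem one_sub_div_le_sin_mul_arccos_sq {n : ℕ} [NeZero n] (hn : 100 * (n : ℝ) ^ 2 ≤ 2 ^ n)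
    {δ : ℝ} (hδ0 : 0 ≤ δ) (hlower : 1 - 3 / n ≤ 2 ^ n * δ) (hupper : 2 ^ n * δ ≤ 1) {t : ℝ}
    (ht : |t - finalTime n| ≤ 1) :
    1 - 36 / n ≤ Real.sin (t * Real.arccos (1 - δ)) ^ 2 := by
  have hangle : (t * Real.arccos (1 - δ) - Real.pi / 2) ^ 2 ≤ (6 / n) ^ 2 :=
    sq_le_sq.2 ((abs_mul_arccos_sub_pi_div_two_le hn hδ0 hlower hupper ht).trans (le_abs_self _))
  calc 1 - 36 / (n : ℝ) ≤ 1 - (6 / n) ^ 2 := by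
        have hn1 : (1 : ℝ) ≤ n := Nat.one_le_cast.2 NeZero.one_le
        rw [div_pow]
        norm_num only
        gcongr
        exact le_self_pow₀ hn1 two_ne_zero
    _ ≤ 1 - (t * Real.arccos (1 - δ) - Real.pi / 2) ^ 2 := by gcongr
    _ ≤ Real.sin (t * Real.arccos (1 - δ)) ^ 2 := one_sub_sq_le_sin_sq _

end Angle

section SuccessProbability

variable {n : ℕ}

theorem add_sub_one_div_two_le_mul_div_two_sub {s μ δ : ℝ} (hs : 0 ≤ s) (hs1 : s ≤ 1) (hμ : 0 ≤ μ)
    (hμ1 : μ ≤ 1) (hδ : 0 ≤ δ) (hδ2 : δ < 2) : (s + μ - 1) / 2 ≤ s * (μ / (2 - δ)) := by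
  calc (s + μ - 1) / 2 ≤ s * μ / 2 := by nlinarith
    _ ≤ s * μ / (2 - δ) := div_le_div_of_nonneg_left (by positivity) (by linarith) (by linarith)
    _ = s * (μ / (2 - δ)) := mul_div_assoc s μ (2 - δ)

theorem mul_div_two_sub_le {s μ δ m : ℝ} (hs1 : s ≤ 1) (hμ : 0 ≤ μ) (hμm : μ ≤ 1 - m / 4)
    (hm : 0 ≤ m) (hδ : 0 ≤ δ) (hδ2 : δ < 2) (hδm : δ ≤ m / 100) :
    s * (μ / (2 - δ)) ≤ 1 / 2 - m / 10 := by
  have hpos : 0 < 2 - δ := by linarith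
  calc s * (μ / (2 - δ)) ≤ μ / (2 - δ) := mul_le_of_le_one_left (by positivity) hs1
    _ ≤ 1 / 2 - m / 10 := by
        rw [div_le_iff₀ hpos]
        linarith [mul_nonneg hm hδ]

theorem two_mul_mul_sqrt_two_pow_mul_le [NeZero n] (hn : 10000 * (n : ℝ) ^ 4 ≤ 2 ^ n) {δ : ℝ}
    (hδ : 2 ^ n * δ ≤ 1) : 2 * (δ * √(2 ^ n) * n) ≤ 1 / n / 50 := by
  have hn0 : (0 : ℝ) < n := Nat.cast_pos.2 (NeZero.pos n)
  have hsqrt : 100 * (n : ℝ) ^ 2 ≤ √(2 ^ n) := Real.le_sqrt_of_sq_le (by linarith)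
  have hamp : δ * √(2 ^ n) ≤ 1 / √(2 ^ n) := by
    rwa [le_div_iff₀ (by positivity), mul_assoc, Real.mul_self_sqrt (by positivity), mul_comm]
  calc 2 * (δ * √(2 ^ n) * n) ≤ 2 * (1 / √(2 ^ n) * n) := by gcongr
    _ ≤ 2 * (1 / (100 * n ^ 2) * n) := by gcongr
    _ = 1 / n / 50 := by
        field_simp
        norm_num

theorem half_sub_nodeProb_mem_Icc [NeZero n] (hn : 10000 * (n : ℝ) ^ 4 ≤ 2 ^ n)
    {f : Node n → Bool} {w : Node n} (hf : ∀ x, f x = true ↔ x = w) {t : ℕ}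
    (ht : |(t : ℝ) - finalTime n| ≤ 1) :
    1 / 2 - nodeProb (walk f ^ t *ᵥ initialState n) w ∈ Set.Icc 0 (20 / n : ℝ) := by
  have hn1 : (1 : ℝ) ≤ n := Nat.one_le_cast.2 NeZero.one_le
  have hn2 : 100 * (n : ℝ) ^ 2 ≤ 2 ^ n := by
    nlinarith [pow_le_pow_right₀ hn1 (show 2 ≤ 4 by simp)]
  obtain ⟨δ, hδ, hroot, hlower, hupper⟩ := exists_green_zero_eq_zero hn2
  set m := 1 / (n : ℝ) with hm
  have hm0 : 0 < m := by positivity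
  have hm1 : m ≤ 1 := div_le_one_of_le₀ hn1 n.cast_nonneg
  have hμm : 2 ^ n * δ ≤ 1 - m / 4 := hupper.trans_eq (by rw [hm]; ring)
  have hμ1 : 2 ^ n * δ ≤ 1 := by linarith
  have hδm : δ ≤ m / 100 := by
    rw [hm, div_div, le_div_iff₀ (by positivity)]
    nlinarith
  set s := Real.sin (t * Real.arccos (1 - δ)) ^ 2
  have hs1 : s ≤ 1 := Real.sin_sq_le_one _
  have hs := one_sub_div_le_sin_mul_arccos_sq hn2 hδ.le hlower hμ1 ht
  obtain ⟨hle, hge⟩ := abs_le.1 <|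
    (abs_nodeProb_walk_pow_initialState_sub_le hf hδ (by linarith) hμ1 hroot t).trans
      (two_mul_mul_sqrt_two_pow_mul_le hn hμ1)
  have hqupper := mul_div_two_sub_le hs1 (by positivity) hμm hm0.le hδ.le (by linarith) hδm
  have hqlower := add_sub_one_div_two_le_mul_div_two_sub (sq_nonneg _) hs1 (by positivity) hμ1 hδ.le
    (by linarith)
  have hdiv (c : ℝ) : c / n = c * m := div_eq_mul_one_div _ _
  constructor <;> linarith [hdiv 3, hdiv 20, hdiv 36]

end SuccessProbability

section Search

variable {n : ℕ}

theorem searchOutput_eq_some_iff {f : Node n → Bool} {w : Node n} (hf : ∀ x, f x = true ↔ x = w)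
    {r : ℕ} (o : Fin r → Label n) : searchOutput f o = some w ↔ ∃ i, (o i).2 = w := by
  constructor
  · intro h
    exact List.mem_ofFn.1 (List.mem_of_find?_eq_some h)
  · rintro ⟨i, hi⟩
    have hfound : (searchOutput f o).isSome := by
      rw [searchOutput, List.find?_isSome]
      exact ⟨w, List.mem_ofFn.2 ⟨i, hi⟩, (hf w).2 rfl⟩
    obtain ⟨x, hx⟩ := Option.isSome_iff_exists.1 hfound
    rw [hx, (hf x).1 (List.find?_some hx)]

theorem repeatedProb_walkSearch [NeZero n] {f : Node n → Bool} {w : Node n}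
    (hf : ∀ x, f x = true ↔ x = w) (t r : ℕ) :
    repeatedProb f (walkSearch n t) r w =
      1 - (1 - nodeProb (walk f ^ t *ᵥ initialState n) w) ^ r := by
  have htotal : ∑ b, outcomeProb (walk f ^ t *ᵥ initialState n) b = 1 := by
    simp only [outcomeProb]
    rw [← EuclideanSpace.norm_sq_eq (WithLp.toLp 2 _), norm_toLp_walk_pow_mulVec_initialState,
      one_pow]
  have hmarked : ∑ b : Label n with b.2 = w, outcomeProb (walk f ^ t *ᵥ initialState n) b =
      nodeProb (walk f ^ t *ᵥ initialState n) w := by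
    simp [Finset.sum_filter, Fintype.sum_prod_type, nodeProb]
  have hrepeat := sum_prod_filter_exists (ι := Fin r) htotal fun b => b.2 = w
  rw [hmarked, Fintype.card_fin] at hrepeat
  simp only [repeatedProb, searchOutput_eq_some_iff hf, run_walkSearch]
  convert hrepeat

theorem one_sub_pow_le_repeatedProb (hn80 : 80 ≤ n) (hn : 10000 * (n : ℝ) ^ 4 ≤ 2 ^ n)
    {f : Node n → Bool} {w : Node n} (hf : ∀ x, f x = true ↔ x = w) {t : ℕ}
    (ht : |(t : ℝ) - finalTime n| ≤ 1) (r : ℕ) :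
    1 - (3 / 4 : ℝ) ^ r ≤ repeatedProb f (walkSearch n t) r w := by
  have : NeZero n := ⟨by omega⟩
  obtain ⟨hupper, hlower⟩ := half_sub_nodeProb_mem_Icc hn hf ht
  have hquarter : (20 : ℝ) / n ≤ 1 / 4 := by
    have hcast : (80 : ℝ) ≤ n := mod_cast hn80
    rw [div_le_div_iff₀ (by linarith) (by norm_num)]
    linarith
  rw [repeatedProb_walkSearch hf]
  gcongr
  · linarith
  · linarith

theorem oracleCalls_walkSearch (n t : ℕ) : oracleCalls (walkSearch n t) = t := by
  simp [oracleCalls, walkSearch, List.map_flatten, Instr.cost]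

theorem natCast_le_three_mul_sqrt {t : ℕ} (ht : |(t : ℝ) - finalTime n| ≤ 1) :
    (t : ℝ) ≤ 3 * √(2 ^ n) := by
  have hsqrt : (1 : ℝ) ≤ √(2 ^ n) := Real.one_le_sqrt.2 (one_le_pow₀ one_le_two)
  have hfinal : finalTime n ≤ 2 * √(2 ^ n) := by
    rw [finalTime]
    gcongr
    · linarith [Real.pi_le_four]
    · exact one_le_two
    · exact n.sub_le 1
  linarith [(abs_le.1 ht).2]

theorem repeatedCalls_walkSearch_le {t : ℕ} (ht : |(t : ℝ) - finalTime n| ≤ 1) (r : ℕ) :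
    (repeatedCalls (walkSearch n t) r : ℝ) ≤ (4 * r) * √(2 ^ n) := by
  have hsqrt : (1 : ℝ) ≤ √(2 ^ n) := Real.one_le_sqrt.2 (one_le_pow₀ one_le_two)
  rw [repeatedCalls, oracleCalls_walkSearch]
  push_cast
  nlinarith [natCast_le_three_mul_sqrt ht, r.cast_nonneg (α := ℝ)]

theorem exists_forall_mul_pow_four_le_two_pow :
    ∃ k : ℕ, ∀ n, k ≤ n → 10000 * (n : ℝ) ^ 4 ≤ 2 ^ n := by
  have hlim := tendsto_pow_const_div_const_pow_of_one_lt 4 (one_lt_two (α := ℝ))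
  obtain ⟨k, hk⟩ := Filter.eventually_atTop.1 (hlim.eventually_le_const
    (show (0 : ℝ) < 1 / 10000 by norm_num))
  refine ⟨k, fun n hn => ?_⟩
  have hle := hk n hn
  rw [div_le_div_iff₀ (by positivity) (by positivity)] at hle
  linarith

end Search

end HypercubeSearch

end

open HypercubeSearch in
theorem mainTheorem1 :
    -- one run: success probability `1/2 - O(1/n)` with `O(√N)` oracle calls, `N = 2 ^ n`
    (∃ C K : ℝ, ∃ k : ℕ, 0 < C ∧ 0 < K ∧ 1 ≤ k ∧
      ∀ n : ℕ, k ≤ n → ∀ (f : Node n → Bool) (w : Node n), (∀ x, f x = true ↔ x = w) →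
        ∀ t : ℕ, |(t : ℝ) - finalTime n| ≤ 1 →
          0 ≤ 1 / 2 - nodeProb (walk f ^ t *ᵥ initialState n) w ∧
          1 / 2 - nodeProb (walk f ^ t *ᵥ initialState n) w ≤ C / n ∧
          run f (walkSearch n t) (initialState n) = walk f ^ t *ᵥ initialState n ∧
          (oracleCalls (walkSearch n t) : ℝ) ≤ K * √((2 : ℝ) ^ n)) ∧
    -- search with arbitrarily small error, by a constant number of repetitions
    (∀ ε : ℝ, 0 < ε → ∃ r : ℕ, ∃ K : ℝ, ∃ k : ℕ, 0 < K ∧ 1 ≤ k ∧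
      ∀ n : ℕ, k ≤ n → ∀ (f : Node n → Bool) (w : Node n), (∀ x, f x = true ↔ x = w) →
        ∀ t : ℕ, |(t : ℝ) - finalTime n| ≤ 1 →
          1 - ε ≤ repeatedProb f (walkSearch n t) r w ∧
          (repeatedCalls (walkSearch n t) r : ℝ) ≤ K * √((2 : ℝ) ^ n)) := by
  obtain ⟨k, hk⟩ := exists_forall_mul_pow_four_le_two_pow
  refine ⟨⟨20, 3, max k 1, by norm_num, by norm_num, le_max_right _ _, ?_⟩, fun ε hε => ?_⟩
  · intro n hn f w hf t ht
    have : NeZero n := ⟨by omega⟩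
    obtain ⟨hupper, hlower⟩ := half_sub_nodeProb_mem_Icc (hk n (by omega)) hf ht
    refine ⟨hupper, hlower, run_walkSearch f t _, ?_⟩
    rw [oracleCalls_walkSearch]
    exact natCast_le_three_mul_sqrt ht
  · obtain ⟨r, hr⟩ := exists_pow_lt_of_lt_one hε (show (3 / 4 : ℝ) < 1 by norm_num)
    refine ⟨r, 4 * r + 1, max k 80, by positivity, le_max_of_le_right (by norm_num), ?_⟩
    intro n hn f w hf t ht
    have hprob := one_sub_pow_le_repeatedProb (by omega) (hk n (by omega)) hf ht r
    refine ⟨by linarith, (repeatedCalls_walkSearch_le ht r).trans ?_⟩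
    gcongr
    linarith
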